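/- Lemma 3.1. Let $V\subset\mathbb P^n(\mathbb C)$ be a smooth (irreducible) projective subvariety of dimension $k$. Let $Q_1,\dots,Q_{N+1}$ be hypersurfaces in $\mathbb P^n(\mathbb C)$ of the same degree $d\ge 1$, each identified with a nonzero homogeneous polynomial of degree $d$ in $\mathbb C[x_0,\dots,x_n]$ defining it, such that $$\Big(\bigcap_{i=1}^{N+1}Q_i\Big)\cap V=\emptyset ,$$ and suppose that $V\not\subset Q_1$. Then there exist $k$ hypersurfaces $P_2,\dots,P_{k+1}$ of degree $d$ of the form $$P_t=\sum_{j=2}^{N-k+t}c_{tj}Q_j,\qquad c_{tj}\in\mathbb C,\quad t=2,\dots,k+1,$$ such that, with $P_1=Q_1$, $$\Big(\bigcap_{t=1}^{k+1}P_t\Big)\cap V=\emptyset .$$ -/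

import Mathlib

/-- Homogeneous coordinates on `ℙⁿ(ℂ)`: polynomials in `x₀, …, xₙ`. -/
abbrev CoordPoly (n : ℕ) : Type := MvPolynomial (Fin (n + 1)) ℂ

/-- The complex projective space `ℙⁿ(ℂ)`, as a set of points. It is a type of its own, so that the
Zariski topology below is its only topology. -/
def ProjSpace (n : ℕ) : Type := Projectivization ℂ (Fin (n + 1) → ℂ)

namespace ProjSpace

variable {n : ℕ}

/-- The point `(v₀ : ⋯ : vₙ)`. -/
noncomputable def mk (v : Fin (n + 1) → ℂ) (hv : v ≠ 0) : ProjSpace n := Projectivization.mk ℂ v hv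

/-- `F` vanishes at `p`: it vanishes at every vector of homogeneous coordinates of `p`. For a
homogeneous `F` one vector of coordinates is enough, see `vanishesAt_mk_iff`. -/
def VanishesAt (F : CoordPoly n) (p : ProjSpace n) : Prop :=
  ∀ (v : Fin (n + 1) → ℂ) (hv : v ≠ 0), mk v hv = p → MvPolynomial.eval v F = 0

theorem exists_mk (p : ProjSpace n) : ∃ (v : Fin (n + 1) → ℂ) (hv : v ≠ 0), mk v hv = p :=
  ⟨Projectivization.rep p, Projectivization.rep_nonzero p, Projectivization.mk_rep p⟩

theorem vanishesAt_mk_iff {F : CoordPoly n} {d : ℕ} (hF : F.IsHomogeneous d)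
    (v : Fin (n + 1) → ℂ) (hv : v ≠ 0) :
    VanishesAt F (mk v hv) ↔ MvPolynomial.eval v F = 0 := by
  refine ⟨fun h => h v hv rfl, fun h w hw hwv => ?_⟩
  obtain ⟨a, ha⟩ := (Projectivization.mk_eq_mk_iff' ℂ w v hw hv).1 hwv
  have key : MvPolynomial.eval (a • v) F = a ^ d * MvPolynomial.eval v F := by
    rw [MvPolynomial.eval_eq', MvPolynomial.eval_eq', Finset.mul_sum]
    refine Finset.sum_congr rfl fun m hm => ?_
    have hdeg : ∑ i, m i = d := by
      rw [← hF (MvPolynomial.mem_support_iff.1 hm), Finsupp.weight_apply, Finsupp.sum_fintype]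
      · simp
      · simp
    simp only [Pi.smul_apply, smul_eq_mul, mul_pow, Finset.prod_mul_distrib,
      Finset.prod_pow_eq_pow_sum, hdeg]
    ring
  rw [← ha, key, h, mul_zero]

/-- The common zero set in `ℙⁿ(ℂ)` of a set of polynomials. -/
def zeroLocus (S : Set (CoordPoly n)) : Set (ProjSpace n) := {p | ∀ F ∈ S, VanishesAt F p}

/-- The hypersurface `{F = 0}` in `ℙⁿ(ℂ)`, as a set of points (all of `ℙⁿ(ℂ)` if `F = 0`). -/
def zeroSet (F : CoordPoly n) : Set (ProjSpace n) := {p | VanishesAt F p}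

/-- Algebraic subsets of `ℙⁿ(ℂ)`: common zero sets of sets of homogeneous polynomials. -/
def IsAlgebraic (Z : Set (ProjSpace n)) : Prop :=
  ∃ S : Set (CoordPoly n), (∀ F ∈ S, ∃ d, F.IsHomogeneous d) ∧ Z = zeroLocus S

/-- The Zariski topology: the closed sets are the algebraic sets. -/
instance zariskiTopology : TopologicalSpace (ProjSpace n) :=
  TopologicalSpace.ofClosed {Z | IsAlgebraic Z}
    (by
      refine ⟨{1}, ?_, ?_⟩
      · rintro F rfl
        exact ⟨0, MvPolynomial.isHomogeneous_one _ _⟩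
      · ext p
        obtain ⟨v, hv, rfl⟩ := exists_mk p
        simp only [Set.mem_empty_iff_false, false_iff]
        intro h
        have := h 1 rfl v hv rfl
        simp at this)
    (by
      intro A hA
      refine ⟨{F | (∃ d, F.IsHomogeneous d) ∧ ∃ Z ∈ A, ∀ p ∈ Z, VanishesAt F p},
        fun F hF => hF.1, ?_⟩
      ext p
      constructor
      · rintro hp F ⟨-, Z, hZ, hF⟩
        exact hF p (hp Z hZ)
      · intro hp Z hZ
        obtain ⟨S, hS, rfl⟩ := hA hZ
        exact fun F hF => hp F ⟨hS F hF, _, hZ, fun q hq => hq F hF⟩)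
    (by
      rintro _ ⟨S, hS, rfl⟩ _ ⟨T, hT, rfl⟩
      refine ⟨{H | ∃ F ∈ S, ∃ G ∈ T, H = F * G}, ?_, ?_⟩
      · rintro _ ⟨F, hF, G, hG, rfl⟩
        obtain ⟨a, ha⟩ := hS F hF
        obtain ⟨b, hb⟩ := hT G hG
        exact ⟨a + b, ha.mul hb⟩
      · ext p
        obtain ⟨v, hv, rfl⟩ := exists_mk p
        constructor
        · rintro (h | h) _ ⟨F, hF, G, hG, rfl⟩ w hw hwv
          · rw [map_mul, h F hF w hw hwv, zero_mul]
          · rw [map_mul, h G hG w hw hwv, mul_zero]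
        · intro h
          by_contra hcon
          simp only [Set.mem_union, zeroLocus, Set.mem_ofPred_eq, not_or, not_forall] at hcon
          obtain ⟨⟨F, hF, hFv⟩, G, hG, hGv⟩ := hcon
          obtain ⟨a, ha⟩ := hS F hF
          obtain ⟨b, hb⟩ := hT G hG
          rw [vanishesAt_mk_iff ha] at hFv
          rw [vanishesAt_mk_iff hb] at hGv
          have := h _ ⟨F, hF, G, hG, rfl⟩ v hv rfl
          rw [map_mul] at this
          exact (mul_ne_zero hFv hGv) this)

theorem isClosed_iff {Z : Set (ProjSpace n)} : IsClosed Z ↔ IsAlgebraic Z := by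
  rw [← isOpen_compl_iff]
  change IsAlgebraic (Zᶜᶜ) ↔ IsAlgebraic Z
  rw [compl_compl]

/-- The ideal `I(V)` of the polynomials that vanish on `V`. -/
def vanishingIdeal (V : Set (ProjSpace n)) : Ideal (CoordPoly n) where
  carrier := {F | ∀ p ∈ V, VanishesAt F p}
  zero_mem' := fun _ _ _ _ _ => map_zero _
  add_mem' := fun hF hG p hp v hv h => by rw [map_add, hF p hp v hv h, hG p hp v hv h, add_zero]
  smul_mem' := fun G F hF p hp v hv h => by
    rw [smul_eq_mul, map_mul, hF p hp v hv h, mul_zero]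

/-- The Zariski tangent space at `v` of the affine cone over `V`: the vectors `w` with
`∑ i, (∂F/∂xᵢ)(v) wᵢ = 0` for all `F ∈ I(V)`. -/
def coneTangentSpace (V : Set (ProjSpace n)) (v : Fin (n + 1) → ℂ) :
    Submodule ℂ (Fin (n + 1) → ℂ) where
  carrier := {w | ∀ F ∈ vanishingIdeal V,
    ∑ i, MvPolynomial.eval v (MvPolynomial.pderiv i F) * w i = 0}
  zero_mem' := fun F _ => by simp
  add_mem' := fun {a b} ha hb F hF => by
    simp only [Pi.add_apply, mul_add, Finset.sum_add_distrib, ha F hF, hb F hF, add_zero]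
  smul_mem' := fun c w hw F hF => by
    simp only [Pi.smul_apply, smul_eq_mul, mul_left_comm _ c, ← Finset.mul_sum, hw F hF, mul_zero]

/-- `V` is a smooth projective subvariety of `ℙⁿ(ℂ)` of dimension `k`: an irreducible Zariski
closed subset whose Krull dimension (the supremum of the lengths of chains of irreducible closed
subsets) is `k`, and which satisfies the Jacobian criterion at each of its points, that is, the
`k + 1` dimensional affine cone over `V` has a Zariski tangent space of dimension `k + 1` at each
of its points other than the origin. -/
structure IsSmoothSubvariety (V : Set (ProjSpace n)) (k : ℕ) : Prop where
  isClosed : IsClosed V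
  isIrreducible : IsIrreducible V
  dim_eq : topologicalKrullDim V = k
  smooth : ∀ (v : Fin (n + 1) → ℂ) (hv : v ≠ 0), mk v hv ∈ V →
    Module.finrank ℂ (coneTangentSpace V v) = k + 1

/-- `F` defines a hypersurface of degree `d` in `ℙⁿ(ℂ)`: it is a nonzero homogeneous polynomial of
degree `d`. -/
def IsHypersurface (d : ℕ) (F : CoordPoly n) : Prop := F.IsHomogeneous d ∧ F ≠ 0

end ProjSpace

/-! Each new form cuts the dimension by one. Start with `V ∩ Q₁`, of dimension less than `k` because
`V` is irreducible and not inside `Q₁`. Suppose the cuts made so far leave `Z` of dimension at most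
`r`, and let `W` be a component of dimension `r`. If `Q₁, …, Q_{N+1-r}` all vanished on `W`, the
last `r` of the `Q`s would have no common zero on `W`, which forces `dim W < r` (`height_lt_card`).
So one of them does not vanish on `W`, and it is not `Q₁`, since `W ⊆ Q₁`. A general combination of
`Q₂, …, Q_{N+1-r}` therefore contains no component of dimension `r`
(`exists_sum_smul_ne_zero_and_dimLT`). After `k` such steps the dimension is less than `0`, so the
intersection is empty.

The bound `height_lt_card` is Krull's height theorem at the vertex of the affine cone over `W`: by
the Nullstellensatz the vertex is the whole common zero set of the forms there, so its ideal has
height at most their number, while a chain of irreducible closed subsets of `W` gives a chain of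
primes strictly below that ideal. -/

/-! ### Restriction of polynomials to lines through the origin -/

/-- The ring homomorphism that restricts a polynomial to the line through the origin and `v`. -/
noncomputable def MvPolynomial.restrictLine {σ R : Type*} [CommSemiring R] (v : σ → R) :
    MvPolynomial σ R →ₐ[R] Polynomial R :=
  MvPolynomial.aeval fun i => Polynomial.C (v i) * Polynomial.X

theorem MvPolynomial.eval_restrictLine {σ R : Type*} [CommSemiring R] (v : σ → R) (t : R)
    (F : MvPolynomial σ R) :
    (MvPolynomial.restrictLine v F).eval t = MvPolynomial.eval (t • v) F := by
  induction F using MvPolynomial.induction_on with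
  | C a => simp [MvPolynomial.restrictLine]
  | add p q hp hq => rw [map_add, Polynomial.eval_add, hp, hq, map_add]
  | mul_X p i hp =>
    rw [map_mul, Polynomial.eval_mul, hp, map_mul]
    rw [MvPolynomial.restrictLine, MvPolynomial.aeval_X, Polynomial.eval_mul, Polynomial.eval_C,
      Polynomial.eval_X, MvPolynomial.eval_X, Pi.smul_apply, smul_eq_mul, mul_comm (v i) t]

theorem MvPolynomial.IsHomogeneous.restrictLine_eq {σ R : Type*} [Fintype σ] [CommSemiring R]
    {F : MvPolynomial σ R} {d : ℕ} (hF : F.IsHomogeneous d) (v : σ → R) :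
    MvPolynomial.restrictLine v F
      = Polynomial.C (MvPolynomial.eval v F) * Polynomial.X ^ d := by
  rw [MvPolynomial.restrictLine, MvPolynomial.aeval_def, MvPolynomial.eval₂_eq',
    MvPolynomial.eval_eq', map_sum, Finset.sum_mul]
  refine Finset.sum_congr rfl fun m hm => ?_
  have hdeg : ∑ i, m i = d := by
    rw [← hF (MvPolynomial.mem_support_iff.1 hm), Finsupp.weight_apply, Finsupp.sum_fintype]
    · simp
    · simp
  simp only [mul_pow, Finset.prod_mul_distrib, Finset.prod_pow_eq_pow_sum, hdeg, map_mul,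
    map_prod, map_pow, Polynomial.algebraMap_eq, mul_assoc]

theorem MvPolynomial.coeff_restrictLine {σ R : Type*} [Fintype σ] [CommSemiring R]
    (F : MvPolynomial σ R) (d : ℕ) (v : σ → R) :
    (MvPolynomial.restrictLine v F).coeff d
      = MvPolynomial.eval v (MvPolynomial.homogeneousComponent d F) := by
  conv_lhs => rw [← MvPolynomial.sum_homogeneousComponent F]
  simp only [map_sum, Polynomial.finsetSum_coeff,
    (MvPolynomial.homogeneousComponent_isHomogeneous _ F).restrictLine_eq,
    Polynomial.coeff_C_mul_X_pow]
  rw [Finset.sum_ite_eq]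
  split_ifs with h
  · rfl
  · rw [MvPolynomial.homogeneousComponent_eq_zero _ _ (by simpa [Nat.lt_succ_iff] using h),
      map_zero]

/-- A strictly antitone map from the elements below `a` to those strictly below `b` forces the
height of `a` to be less than that of `b`. -/
theorem Order.height_lt_of_strictAnti {α β : Type*} [Preorder α] [Preorder β] {a : α} {b : β}
    (f : Set.Iic a → β) (hf : StrictAnti f) (hfb : ∀ x, f x < b) {r : ℕ}
    (hb : Order.height b ≤ r) : Order.height a < r := by
  by_contra! h
  have h' : ((r : ℕ) : WithBot ℕ∞) ≤ Order.krullDim (Set.Iic a) := by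
    rw [← Order.height_eq_krullDim_Iic]
    exact_mod_cast h
  obtain ⟨p, hp⟩ := Order.le_krullDim_iff.1 h'
  -- Reversing the chain undoes the antitone `f`; appending `b` on top gains one step.
  let q : LTSeries β := LTSeries.mk p.length (fun i => f (p i.rev))
    fun i j hij => hf (p.strictMono (Fin.rev_lt_rev.2 hij))
  have hlen : ((q.snoc b (hfb _)).length : ℕ∞) ≤ r :=
    (Order.length_le_height (RelSeries.last_snoc q b (hfb _)).le).trans hb
  have hr : (q.snoc b (hfb _)).length = r + 1 := congrArg (· + 1) hp
  rw [hr] at hlen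
  exact absurd hlen (by norm_cast; omega)

/-! ### Vanishing ideals and the Zariski topology -/

namespace ProjSpace

variable {n : ℕ}

/-- The nonzero multiples of `v` give infinitely many roots. Vanishing of an inhomogeneous `F` thus
becomes an identity in the domain `ℂ[X]`. -/
theorem vanishesAt_mk_iff_restrictLine_eq_zero {F : CoordPoly n} (v : Fin (n + 1) → ℂ)
    (hv : v ≠ 0) : VanishesAt F (mk v hv) ↔ MvPolynomial.restrictLine v F = 0 := by
  constructor
  · intro h
    refine Polynomial.eq_zero_of_infinite_isRoot _
      ((Set.finite_singleton (0 : ℂ)).infinite_compl.mono fun t ht => ?_)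
    rw [Set.mem_ofPred_eq, Polynomial.IsRoot.def, MvPolynomial.eval_restrictLine]
    exact h _ (smul_ne_zero ht hv) ((Projectivization.mk_eq_mk_iff' ℂ _ _ _ hv).2 ⟨t, rfl⟩)
  · intro h w hw hwv
    obtain ⟨a, rfl⟩ := (Projectivization.mk_eq_mk_iff' ℂ w v hw hv).1 hwv
    rw [← MvPolynomial.eval_restrictLine, h, Polynomial.eval_zero]

theorem vanishesAt_mul {F G : CoordPoly n} {p : ProjSpace n} :
    VanishesAt (F * G) p ↔ VanishesAt F p ∨ VanishesAt G p := by
  obtain ⟨v, hv, rfl⟩ := exists_mk p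
  simp only [vanishesAt_mk_iff_restrictLine_eq_zero, map_mul, mul_eq_zero]

/-- The coefficients of `F` along a line are the values of its homogeneous components, so these
components cut out the same set. -/
theorem isClosed_zeroSet (F : CoordPoly n) : IsClosed (zeroSet F) := by
  refine isClosed_iff.2 ⟨Set.range fun d => MvPolynomial.homogeneousComponent d F, ?_, ?_⟩
  · rintro _ ⟨d, rfl⟩
    exact ⟨d, MvPolynomial.homogeneousComponent_isHomogeneous _ _⟩
  · ext p
    obtain ⟨v, hv, rfl⟩ := exists_mk p
    simp only [zeroSet, zeroLocus, Set.mem_ofPred_eq, Set.forall_mem_range,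
      vanishesAt_mk_iff_restrictLine_eq_zero v hv (F := F), Polynomial.ext_iff,
      MvPolynomial.coeff_restrictLine, Polynomial.coeff_zero,
      vanishesAt_mk_iff (MvPolynomial.homogeneousComponent_isHomogeneous _ F)]

theorem mem_of_forall_mem_vanishingIdeal {Z : Set (ProjSpace n)} (hZ : IsClosed Z)
    {v : Fin (n + 1) → ℂ} (hv : v ≠ 0)
    (h : ∀ F ∈ vanishingIdeal Z, MvPolynomial.eval v F = 0) : mk v hv ∈ Z := by
  obtain ⟨S, hS, rfl⟩ := isClosed_iff.1 hZ
  intro F hF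
  obtain ⟨d, hd⟩ := hS F hF
  exact (vanishesAt_mk_iff hd v hv).2 (h F fun p hp => hp F hF)

theorem vanishingIdeal_anti {Z W : Set (ProjSpace n)} (h : Z ⊆ W) :
    vanishingIdeal W ≤ vanishingIdeal Z := fun _ hF => h.trans hF

theorem subset_of_vanishingIdeal_le {Z W : Set (ProjSpace n)} (hW : IsClosed W)
    (h : vanishingIdeal W ≤ vanishingIdeal Z) : Z ⊆ W := by
  intro p hp
  obtain ⟨v, hv, rfl⟩ := exists_mk p
  exact mem_of_forall_mem_vanishingIdeal hW hv fun F hF => h hF _ hp v hv rfl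

/-- A descending chain of closed sets gives an ascending chain of ideals in a Noetherian ring. -/
instance : TopologicalSpace.NoetherianSpace (ProjSpace n) := by
  refine ((TopologicalSpace.noetherianSpace_TFAE _).out 0 1).2 ?_
  refine StrictAnti.wellFoundedLT
    (f := fun Z : TopologicalSpace.Closeds (ProjSpace n) => vanishingIdeal (Z : Set (ProjSpace n)))
    fun Z W h => ?_
  exact lt_of_le_not_ge (vanishingIdeal_anti h.le)
    fun hle => h.not_ge (subset_of_vanishingIdeal_le Z.isClosed hle)

theorem vanishingIdeal_isPrime {Z : Set (ProjSpace n)} (hZ : IsIrreducible Z) :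
    (vanishingIdeal Z).IsPrime := by
  refine ⟨fun h => ?_, fun {F G} hFG => ?_⟩
  · obtain ⟨p, hp⟩ := hZ.nonempty
    obtain ⟨v, hv, rfl⟩ := exists_mk p
    have := (Ideal.eq_top_iff_one _).1 h _ hp v hv rfl
    simp at this
  · exact isPreirreducible_iff_isClosed_union_isClosed.1 hZ.2 _ _ (isClosed_zeroSet F)
      (isClosed_zeroSet G) fun p hp => vanishesAt_mul.1 (hFG p hp)

/-! ### Dimension bound from the Nullstellensatz and Krull's height theorem -/

/-- The irrelevant ideal: the ideal of the polynomials that vanish at the origin. -/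
noncomputable def irrelevantIdeal (n : ℕ) : Ideal (CoordPoly n) :=
  RingHom.ker (MvPolynomial.eval (0 : Fin (n + 1) → ℂ))

instance : (irrelevantIdeal n).IsPrime := RingHom.ker_isPrime _

/-- A polynomial that is zero along a line through the origin is zero at the origin. The inclusion
is strict because some coordinate of a point is nonzero. -/
theorem vanishingIdeal_lt_irrelevantIdeal {Z : Set (ProjSpace n)} (hZ : Z.Nonempty) :
    vanishingIdeal Z < irrelevantIdeal n := by
  obtain ⟨p, hp⟩ := hZ
  obtain ⟨v, hv, rfl⟩ := exists_mk p
  refine lt_of_le_not_ge (fun F hF => ?_) fun hle => hv (funext fun i => ?_)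
  · have := (vanishesAt_mk_iff_restrictLine_eq_zero v hv).1 (hF _ hp)
    rw [irrelevantIdeal, RingHom.mem_ker, ← zero_smul ℂ v, ← MvPolynomial.eval_restrictLine, this,
      Polynomial.eval_zero]
  · have hX : MvPolynomial.X i ∈ irrelevantIdeal n := by simp [irrelevantIdeal, RingHom.mem_ker]
    simpa using hle hX _ hp v hv rfl

theorem mem_irrelevantIdeal_of_isHomogeneous {F : CoordPoly n} {d : ℕ} (hF : F.IsHomogeneous d)
    (hd : 1 ≤ d) : F ∈ irrelevantIdeal n := by
  have h := MvPolynomial.eval_restrictLine 0 0 F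
  rw [hF.restrictLine_eq, smul_zero] at h
  rw [irrelevantIdeal, RingHom.mem_ker, ← h]
  simp [Nat.one_le_iff_ne_zero.1 hd]

/-- By the Nullstellensatz, the irrelevant ideal is the only prime ideal that contains `I(Z)` and
homogeneous polynomials without common zero on `Z`. -/
theorem irrelevantIdeal_le_of_forall_exists_not_vanishesAt {Z : Set (ProjSpace n)}
    (hZ : IsClosed Z) {T : Set (CoordPoly n)} (hT : ∀ F ∈ T, ∃ d, F.IsHomogeneous d)
    (hZT : ∀ p ∈ Z, ∃ F ∈ T, ¬ VanishesAt F p) {q : Ideal (CoordPoly n)} [q.IsPrime]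
    (hZq : vanishingIdeal Z ≤ q) (hTq : T ⊆ q) : irrelevantIdeal n ≤ q := by
  intro F hF
  -- The prime `q` is the ideal of its affine zero locus, so it suffices that this locus contains no
  -- point but the origin.
  rw [← MvPolynomial.IsPrime.vanishingIdeal_zeroLocus (K := ℂ) q,
    MvPolynomial.mem_vanishingIdeal_iff]
  intro x hx
  simp only [MvPolynomial.mem_zeroLocus_iff, MvPolynomial.aeval_eq_eval] at hx
  have hx0 : x = 0 := by
    by_contra hne
    obtain ⟨G, hG, hGx⟩ := hZT _ (mem_of_forall_mem_vanishingIdeal hZ hne fun G hG => hx G (hZq hG))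
    obtain ⟨d, hd⟩ := hT G hG
    exact hGx ((vanishesAt_mk_iff hd x hne).2 (hx G (hTq hG)))
  subst hx0
  exact hF

/-- The dimension of an irreducible closed set on which `r` forms of positive degree have no common
zero is less than `r`. -/
theorem height_lt_card {ι : Type*} (Z : TopologicalSpace.IrreducibleCloseds (ProjSpace n))
    (s : Finset ι) (F : ι → CoordPoly n) {d : ℕ} (hd : 1 ≤ d)
    (hF : ∀ i ∈ s, (F i).IsHomogeneous d) (hZ : ∀ p ∈ Z, ∃ i ∈ s, ¬ VanishesAt (F i) p) :
    Order.height Z < s.card := by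
  classical
  -- Modulo `I(Z)`, only primes above `I(Z)` count towards the height.
  let π := Ideal.Quotient.mk (vanishingIdeal (Z : Set (ProjSpace n)))
  have hπ : Function.Surjective π := Ideal.Quotient.mk_surjective
  have hker : RingHom.ker π = vanishingIdeal (Z : Set (ProjSpace n)) := Ideal.mk_ker
  have hcomap : ∀ I : Ideal (CoordPoly n), vanishingIdeal (Z : Set (ProjSpace n)) ≤ I →
      (I.map π).comap π = I := fun I hI => by
    rw [Ideal.comap_map_of_surjective' π hπ, hker, sup_eq_left.2 hI]
  have hmap : ∀ I J : Ideal (CoordPoly n), vanishingIdeal (Z : Set (ProjSpace n)) ≤ I →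
      I < J → I.map π < J.map π := fun I J hI hIJ =>
    lt_of_le_not_ge (Ideal.map_mono hIJ.le) fun hle => hIJ.not_ge <| by
      rw [← hcomap I hI, ← hcomap J (hI.trans hIJ.le)]
      exact Ideal.comap_mono hle
  have hZm := vanishingIdeal_lt_irrelevantIdeal Z.isIrreducible.nonempty
  have hmprime : ((irrelevantIdeal n).map π).IsPrime :=
    Ideal.map_isPrime_of_surjective hπ (hker.trans_le hZm.le)
  have hprime : ∀ W : Set.Iic Z,
      ((vanishingIdeal (W.1 : Set (ProjSpace n))).map π).IsPrime := fun W =>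
    have := vanishingIdeal_isPrime W.1.isIrreducible
    Ideal.map_isPrime_of_surjective hπ (hker.trans_le (vanishingIdeal_anti W.2))
  refine Order.height_lt_of_strictAnti (b := (⟨_, hmprime⟩ : PrimeSpectrum _))
    (fun W : Set.Iic Z => (⟨_, hprime W⟩ : PrimeSpectrum _)) ?_ ?_ ?_
  · intro W W' h
    refine hmap _ _ (vanishingIdeal_anti W'.2) (lt_of_le_not_ge (vanishingIdeal_anti h.le) ?_)
    exact fun hle => h.not_ge (subset_of_vanishingIdeal_le W.1.isClosed hle)
  · exact fun W => hmap _ _ (vanishingIdeal_anti W.2)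
      (vanishingIdeal_lt_irrelevantIdeal W.1.isIrreducible.nonempty)
  · rw [← PrimeSpectrum.height_eq_orderHeight]
    -- Minimality over the ideal of the forms is what Krull's height theorem requires.
    have hmin : (irrelevantIdeal n).map π ∈
        (Ideal.span (s.image (π ∘ F) : Set (_ ⧸ vanishingIdeal (Z : Set _)))).minimalPrimes := by
      refine ⟨⟨hmprime, Ideal.span_le.2 ?_⟩, fun q hq _ => ?_⟩
      · intro x hx
        obtain ⟨i, hi, rfl⟩ := Finset.mem_image.1 (Finset.mem_coe.1 hx)
        exact Ideal.mem_map_of_mem π (mem_irrelevantIdeal_of_isHomogeneous (hF i hi) hd)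
      · have := hq.1
        refine Ideal.map_le_iff_le_comap.2
          (irrelevantIdeal_le_of_forall_exists_not_vanishesAt Z.isClosed (T := F '' s) ?_ ?_ ?_ ?_)
        · rintro _ ⟨i, hi, rfl⟩
          exact ⟨d, hF i hi⟩
        · intro p hp
          obtain ⟨i, hi, h⟩ := hZ p hp
          exact ⟨_, ⟨i, hi, rfl⟩, h⟩
        · exact hker.symm.trans_le (Ideal.ker_le_comap π)
        · rintro _ ⟨i, hi, rfl⟩
          exact hq.2 (Ideal.subset_span (Finset.mem_coe.2 (Finset.mem_image_of_mem (π ∘ F) hi)))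
    exact (Ideal.height_le_card_of_mem_minimalPrimes_span_finset hmin).trans
      (by exact_mod_cast Finset.card_image_le)

end ProjSpace

/-! ### Dimension of closed subsets -/

theorem IsIrreducible.preimage_of_isClosedEmbedding {X Y : Type*} [TopologicalSpace X]
    [TopologicalSpace Y] {f : Y → X} (hf : Topology.IsClosedEmbedding f) {s : Set X}
    (hs : IsIrreducible s) (hsf : s ⊆ Set.range f) : IsIrreducible (f ⁻¹' s) := by
  refine ⟨hs.nonempty.preimage' hsf, isPreirreducible_iff_isClosed_union_isClosed.2
    fun z₁ z₂ h₁ h₂ h => ?_⟩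
  have hle : s ⊆ f '' z₁ ∪ f '' z₂ := by
    rw [← Set.image_union, ← Set.image_preimage_eq_of_subset hsf]
    exact Set.image_mono h
  refine (isPreirreducible_iff_isClosed_union_isClosed.1 hs.2 _ _ (hf.isClosedMap _ h₁)
    (hf.isClosedMap _ h₂) hle).imp ?_ ?_ <;>
  exact fun h' => (Set.preimage_mono h').trans (Set.preimage_image_eq _ hf.injective).le

open TopologicalSpace in
/-- The irreducible closed subsets of a closed subspace `V` are those contained in `V`. -/
theorem TopologicalSpace.IrreducibleCloseds.height_eq_topologicalKrullDim {X : Type*}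
    [TopologicalSpace X] (V : IrreducibleCloseds X) :
    (Order.height V : WithBot ℕ∞) = topologicalKrullDim (V : Set X) := by
  let φ : ↥(V : Set X) → X := Subtype.val
  have hφ : Topology.IsClosedEmbedding φ := V.isClosed.isClosedEmbedding_subtypeVal
  have hrange : Set.range φ = V := Subtype.range_coe
  rw [Order.height_eq_krullDim_Iic, topologicalKrullDim]
  apply le_antisymm
  · have hW : ∀ W : Set.Iic V, (W.1 : Set X) ⊆ Set.range φ := fun W => hrange.symm ▸ W.2
    refine Order.krullDim_le_of_strictMono (fun W : Set.Iic V => ⟨φ ⁻¹' (W.1 : Set X),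
      W.1.isIrreducible.preimage_of_isClosedEmbedding hφ (hW W),
      W.1.isClosed.preimage hφ.continuous⟩) fun W W' h => ?_
    exact lt_of_le_not_ge (Set.preimage_mono (f := φ) (show (W.1 : Set X) ⊆ W'.1 from h.le)) fun hle =>
      h.not_ge ((Set.preimage_subset_preimage_iff (hW W')).1 hle)
  · refine Order.krullDim_le_of_strictMono
      (fun W => (⟨IrreducibleCloseds.map φ hφ.continuous W, ?_⟩ : Set.Iic V))
      fun W W' h => IrreducibleCloseds.map_strictMono_of_isInducing hφ.isInducing h
    exact closure_minimal ((Set.image_subset_range φ _).trans_eq hrange) V.isClosed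

/-- `Z` has dimension less than `m`: each irreducible closed subset of `Z` has. -/
def Set.DimLT {X : Type*} [TopologicalSpace X] (Z : Set X) (m : ℕ) : Prop :=
  ∀ W : TopologicalSpace.IrreducibleCloseds X, (W : Set X) ⊆ Z → Order.height W < m

theorem Set.DimLT.eq_empty {X : Type*} [TopologicalSpace X] {Z : Set X} (h : Z.DimLT 0)
    (hZ : IsClosed Z) : Z = ∅ := by
  refine Set.eq_empty_of_forall_notMem fun p hp => ?_
  have := h ⟨closure {p}, isIrreducible_singleton.closure, isClosed_closure⟩
    (closure_minimal (Set.singleton_subset_iff.2 hp) hZ)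
  simp at this

/-- Cutting with a closed set that contains no top-dimensional component lowers the dimension. -/
theorem Set.DimLT.inter {X : Type*} [TopologicalSpace X] {Z H : Set X} {m : ℕ}
    (h : Z.DimLT (m + 1)) {S : Set (Set X)} (hS : S.Finite) (hSc : ∀ T ∈ S, IsClosed T)
    (hSi : ∀ T ∈ S, IsIrreducible T) (hZ : Z = ⋃₀ S)
    (hH : ∀ W : TopologicalSpace.IrreducibleCloseds X, (W : Set X) ∈ S → Order.height W = m →
      ¬ (W : Set X) ⊆ H) : (Z ∩ H).DimLT m := by
  intro W hW
  obtain ⟨T, hT, hWT⟩ := isIrreducible_iff_sUnion_isClosed.1 W.isIrreducible hS.toFinset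
    (fun T hT => hSc T (hS.mem_toFinset.1 hT))
    (by rw [hS.coe_toFinset, ← hZ]; exact hW.trans Set.inter_subset_left)
  rw [hS.mem_toFinset] at hT
  let T' : TopologicalSpace.IrreducibleCloseds X := ⟨T, hSi T hT, hSc T hT⟩
  have hT'Z : (T' : Set X) ⊆ Z := hZ ▸ Set.subset_sUnion_of_mem hT
  have hT'm : Order.height T' ≤ m := ENat.lt_natCast_add_one_iff.1 (by exact_mod_cast h T' hT'Z)
  have hWT' : W ≤ T' := hWT
  rcases hWT'.eq_or_lt with heq | hlt
  -- If `W` is the whole component `T'`, then `hH` rules out height `m`; a proper closed subset has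
  -- smaller height anyway.
  · refine lt_of_le_of_ne (heq ▸ hT'm) fun hm => hH T' hT (heq ▸ hm) ?_
    rw [← heq]
    exact hW.trans Set.inter_subset_right
  · have hfin : Order.height W < ⊤ :=
      (Order.height_mono hWT').trans_lt (hT'm.trans_lt (ENat.natCast_lt_top m))
    exact (Order.height_strictMono hlt hfin).trans_le hT'm

/-! ### General linear combinations of forms -/

namespace ProjSpace

variable {n : ℕ}

/-- A general linear combination of forms that do not all vanish on any of the top-dimensional
components of `Z` lowers the dimension of `Z`. -/
theorem exists_sum_smul_ne_zero_and_dimLT {ι : Type*} {Z : Set (ProjSpace n)} (hZ : IsClosed Z)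
    {m d : ℕ} (hm : Z.DimLT (m + 1)) (J : Finset ι) (Q : ι → CoordPoly n)
    (hQ : ∀ j ∈ J, (Q j).IsHomogeneous d) (hQ0 : ∃ j ∈ J, Q j ≠ 0)
    (hJ : ∀ W : TopologicalSpace.IrreducibleCloseds (ProjSpace n), (W : Set (ProjSpace n)) ⊆ Z →
      Order.height W = m → ∃ j ∈ J, ¬ (W : Set (ProjSpace n)) ⊆ zeroSet (Q j)) :
    ∃ c : ι → ℂ, ∑ j ∈ J, c j • Q j ≠ 0 ∧ (Z ∩ zeroSet (∑ j ∈ J, c j • Q j)).DimLT m := by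
  classical
  obtain ⟨S, hS, hSc, hSi, hZS⟩ :=
    TopologicalSpace.NoetherianSpace.exists_finite_set_isClosed_irreducible hZ
  let A := {W : TopologicalSpace.IrreducibleCloseds (ProjSpace n) //
    (W : Set (ProjSpace n)) ∈ S ∧ Order.height W = m}
  have : Finite S := hS
  have : Finite A := Finite.of_injective (fun W : A => (⟨W.1, W.2.1⟩ : S))
    fun W W' h => Subtype.ext (SetLike.coe_injective (congrArg Subtype.val h))
  have hA : ∀ W : A, ∃ (v : Fin (n + 1) → ℂ) (hv : v ≠ 0), mk v hv ∈ W.1 ∧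
      ∃ j ∈ J, MvPolynomial.eval v (Q j) ≠ 0 := fun W => by
    obtain ⟨j, hj, hWj⟩ := hJ W.1 (hZS ▸ Set.subset_sUnion_of_mem W.2.1) W.2.2
    obtain ⟨p, hp, hpj⟩ := Set.not_subset.1 hWj
    obtain ⟨v, hv, rfl⟩ := exists_mk p
    exact ⟨v, hv, hp, j, hj, fun h => hpj ((vanishesAt_mk_iff (hQ j hj) v hv).2 h)⟩
  choose v hv hvW hvJ using hA
  obtain ⟨v₀, hv₀⟩ : ∃ v₀ : Fin (n + 1) → ℂ, ∃ j ∈ J, MvPolynomial.eval v₀ (Q j) ≠ 0 := by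
    obtain ⟨j, hj, hj0⟩ := hQ0
    by_contra! h
    exact hj0 (MvPolynomial.funext fun x => by rw [h x j hj, map_zero])
  -- One linear form in `c` for each top-dimensional component, evaluating the combination at a
  -- chosen point of it. The extra index `none` keeps the combination nonzero even when there is no
  -- such component.
  let f : Option A → Module.Dual ℂ (ι → ℂ) := fun o =>
    ∑ j ∈ J, MvPolynomial.eval (o.elim v₀ v) (Q j) • LinearMap.proj j
  have hf : ∀ o c, f o c = MvPolynomial.eval (o.elim v₀ v) (∑ j ∈ J, c j • Q j) := fun o c => by
    simp [f, LinearMap.sum_apply, mul_comm]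
  -- Over an infinite field, finitely many nonzero linear forms are simultaneously nonzero at some
  -- `c`.
  obtain ⟨c, hc⟩ := Module.Dual.exists_forall_ne_zero_of_forall_exists f fun o => by
    obtain ⟨j, hj, hjv⟩ : ∃ j ∈ J, MvPolynomial.eval (o.elim v₀ v) (Q j) ≠ 0 := by
      cases o
      exacts [hv₀, hvJ _]
    refine ⟨Pi.single j 1, ?_⟩
    rw [hf, Finset.sum_eq_single_of_mem j hj fun i _ hij => by rw [Pi.single_eq_of_ne hij, zero_smul],
      Pi.single_eq_same, one_smul]
    exact hjv
  refine ⟨c, fun h => hc none (by rw [hf, h, map_zero]), hm.inter hS hSc hSi hZS ?_⟩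
  intro W hWS hWm hle
  exact hc (some ⟨W, hWS, hWm⟩) ((hf _ _).trans (hle (hvW ⟨W, hWS, hWm⟩) _ (hv _) rfl))

/-- If the forms `Q i`, `i ∈ I`, have no common zero on `W` and `s ⊆ I` has at most `dim W` elements,
then some `Q i` with `i ∈ I \ s` does not vanish identically on `W`. -/
theorem exists_not_subset_zeroSet {ι : Type*} [DecidableEq ι] {d : ℕ} (hd : 1 ≤ d) (I s : Finset ι)
    (Q : ι → CoordPoly n) (hQ : ∀ i ∈ I, (Q i).IsHomogeneous d)
    (W : TopologicalSpace.IrreducibleCloseds (ProjSpace n))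
    (hW : ∀ p ∈ W, ∃ i ∈ I, ¬ VanishesAt (Q i) p) (hs : s ⊆ I)
    (hWs : (s.card : ℕ∞) ≤ Order.height W) :
    ∃ i ∈ I \ s, ¬ (W : Set (ProjSpace n)) ⊆ zeroSet (Q i) := by
  by_contra! h
  refine hWs.not_gt (height_lt_card W s Q hd (fun i hi => hQ i (hs hi)) fun p hp => ?_)
  obtain ⟨i, hi, hip⟩ := hW p hp
  exact ⟨i, by_contra fun his => hip (h i (Finset.mem_sdiff.2 ⟨hi, his⟩) hp), hip⟩

end ProjSpace

/-! ### Successive cuts of `V` -/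

theorem lemma3p1 (n k N d : ℕ) (hd : 1 ≤ d)
    (V : Set (ProjSpace n)) (hV : ProjSpace.IsSmoothSubvariety V k)
    (Q : ℕ → CoordPoly n)
    (hQ : ∀ i ∈ Finset.Icc 1 (N + 1), ProjSpace.IsHypersurface d (Q i))
    (hVQ : ¬ V ⊆ ProjSpace.zeroSet (Q 1))
    (hempty : (⋂ i ∈ Finset.Icc 1 (N + 1), ProjSpace.zeroSet (Q i)) ∩ V = ∅) :
    ∃ (P : ℕ → CoordPoly n) (c : ℕ → ℕ → ℂ),
      P 1 = Q 1 ∧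
      (∀ t ∈ Finset.Icc 2 (k + 1),
        ProjSpace.IsHypersurface d (P t) ∧
        P t = ∑ j ∈ Finset.Icc 2 (N + t - k), c t j • Q j) ∧
      (⋂ t ∈ Finset.Icc 1 (k + 1), ProjSpace.zeroSet (P t)) ∩ V = ∅ := by
  let V' : TopologicalSpace.IrreducibleCloseds (ProjSpace n) := ⟨V, hV.isIrreducible, hV.isClosed⟩
  have hheight : Order.height V' = k := by
    have h := V'.height_eq_topologicalKrullDim.trans hV.dim_eq
    exact_mod_cast h
  have hQh : ∀ i ∈ Finset.Icc 1 (N + 1), (Q i).IsHomogeneous d := fun i hi => (hQ i hi).1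
  have hQV : ∀ p ∈ V, ∃ i ∈ Finset.Icc 1 (N + 1), ¬ ProjSpace.VanishesAt (Q i) p := by
    intro p hp
    by_contra! h
    exact (hempty ▸ ⟨Set.mem_iInter₂.2 h, hp⟩ : p ∈ (∅ : Set (ProjSpace n)))
  -- Hence the truncated subtraction `N + t - k` is the true upper index `N - k + t`.
  have hkN : k ≤ N := by
    have h := ProjSpace.height_lt_card V' _ Q hd hQh hQV
    rw [hheight, Nat.card_Icc] at h
    exact Nat.lt_succ_iff.1 (by exact_mod_cast h)
  have hclosed : ∀ (P : ℕ → CoordPoly n) (m : ℕ),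
      IsClosed ((⋂ t ∈ Finset.Icc 1 m, ProjSpace.zeroSet (P t)) ∩ V) := fun P m =>
    (isClosed_biInter fun t _ => ProjSpace.isClosed_zeroSet (P t)).inter hV.isClosed
  have key : ∀ m ≤ k, ∃ (P : ℕ → CoordPoly n) (c : ℕ → ℕ → ℂ), P 1 = Q 1 ∧
      (∀ t ∈ Finset.Icc 2 (m + 1), ProjSpace.IsHypersurface d (P t) ∧
        P t = ∑ j ∈ Finset.Icc 2 (N + t - k), c t j • Q j) ∧
      ((⋂ t ∈ Finset.Icc 1 (m + 1), ProjSpace.zeroSet (P t)) ∩ V).DimLT (k - m) := by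
    intro m
    induction m with
    | zero =>
      refine fun _ => ⟨Q, 0, rfl, fun t ht => ?_, ?_⟩
      · rw [Finset.mem_Icc] at ht
        omega
      · have hVdim : V.DimLT (k + 1) := fun W hW => by
          refine (Order.height_mono (show W ≤ V' from hW)).trans_lt ?_
          rw [hheight]
          exact_mod_cast k.lt_succ_self
        have h := hVdim.inter (H := ProjSpace.zeroSet (Q 1)) (Set.finite_singleton V)
          (by rintro _ rfl; exact hV.isClosed) (by rintro _ rfl; exact hV.isIrreducible)
          (Set.sUnion_singleton V).symm fun W hW _ => by rwa [Set.mem_singleton_iff.1 hW]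
        simpa [Set.inter_comm] using h
    | succ m ih =>
      intro hm
      obtain ⟨P, c, hP1, hP, hdim⟩ := ih (by omega)
      -- Here `r` is the largest dimension still possible, and the upper index for `t = m + 2` is `N
      -- + 1 - r`.
      obtain ⟨r, rfl⟩ : ∃ r, k = m + 1 + r := ⟨k - (m + 1), by omega⟩
      rw [show m + 1 + r - m = r + 1 by omega] at hdim
      have hsub : ∀ j ∈ Finset.Icc 2 (N + (m + 2) - (m + 1 + r)), j ∈ Finset.Icc 1 (N + 1) := by
        intro j hj
        rw [Finset.mem_Icc] at hj ⊢
        omega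
      obtain ⟨b, hb0, hb⟩ := ProjSpace.exists_sum_smul_ne_zero_and_dimLT (hclosed P (m + 1)) hdim
        (Finset.Icc 2 (N + (m + 2) - (m + 1 + r))) Q (fun j hj => hQh j (hsub j hj))
        ⟨2, Finset.mem_Icc.2 (by omega), (hQ 2 (Finset.mem_Icc.2 (by omega))).2⟩ (by
          intro W hW hWr
          -- Setting aside exactly the last `r` indices leaves `1, …, N + 1 - r`.
          obtain ⟨i, hi, hWi⟩ := ProjSpace.exists_not_subset_zeroSet hd (Finset.Icc 1 (N + 1))
            (Finset.Icc (N + 2 - r) (N + 1)) Q hQh W (fun p hp => hQV p (hW hp).2)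
            (Finset.Icc_subset_Icc_left (by omega))
            (by rw [hWr, Nat.card_Icc]; exact_mod_cast (by omega))
          refine ⟨i, ?_, hWi⟩
          have hi1 : i ≠ 1 := by
            rintro rfl
            refine hWi fun p hp => hP1 ▸ Set.mem_iInter₂.1 (hW hp).1 1 ?_
            rw [Finset.mem_Icc]
            omega
          rw [Finset.mem_sdiff, Finset.mem_Icc, Finset.mem_Icc] at hi
          rw [Finset.mem_Icc]
          omega)
      refine ⟨Function.update P (m + 2) (∑ j ∈ Finset.Icc 2 (N + (m + 2) - (m + 1 + r)), b j • Q j),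
        Function.update c (m + 2) b, ?_, fun t ht => ?_, ?_⟩
      · rw [Function.update_of_ne (by omega), hP1]
      · rcases eq_or_ne t (m + 2) with rfl | hne
        · rw [Function.update_self, Function.update_self]
          refine ⟨⟨MvPolynomial.IsHomogeneous.sum _ _ _ fun j hj => ?_, hb0⟩, rfl⟩
          rw [MvPolynomial.smul_eq_C_mul]
          exact (hQh j (hsub j hj)).C_mul _
        · rw [Function.update_of_ne hne, Function.update_of_ne hne]
          refine hP t ?_
          rw [Finset.mem_Icc] at ht ⊢
          omega
      · rw [show m + 1 + r - (m + 1) = r by omega]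
        refine fun W hW => hb W (hW.trans fun p hp => ?_)
        refine ⟨⟨Set.mem_iInter₂.2 fun t ht => ?_, hp.2⟩, ?_⟩
        · rw [Finset.mem_Icc] at ht
          have := Set.mem_iInter₂.1 hp.1 t (Finset.mem_Icc.2 (by omega))
          rwa [Function.update_of_ne (by omega)] at this
        · have := Set.mem_iInter₂.1 hp.1 (m + 2) (Finset.mem_Icc.2 (by omega))
          rwa [Function.update_self] at this
  obtain ⟨P, c, hP1, hP, hdim⟩ := key k le_rfl
  rw [Nat.sub_self] at hdim
  exact ⟨P, c, hP1, hP, hdim.eq_empty (hclosed P (k + 1))⟩
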